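/- All groups are finite. Let $\sigma=\{\sigma_i\mid i\in I\}$ be a partition of the set of all primes, i.e. $\bigcup_{i\in I}\sigma_i$ is the set of all primes and $\sigma_i\cap\sigma_j=\emptyset$ for $i\neq j$. A group is $\sigma$-primary if, for some $i\in I$, all prime divisors of its order lie in $\sigma_i$; it is $\sigma$-nilpotent if it is a direct product of finitely many $\sigma$-primary groups, and $\mathfrak N_\sigma$ is the class of all $\sigma$-nilpotent groups. For a group $S$, $S^{\mathfrak N_\sigma}$ denotes the intersection of all normal subgroups $N$ of $S$ with $S/N\in\mathfrak N_\sigma$. For $A\le B$, $A_B$ denotes the largest normal subgroup of $B$ contained in $A$. A subgroup $S$ of $G$ is $\sigma$-subnormal in $G$ if there is a chain $S=A_0\le A_1\le\dots\le A_n=G$ such that for each $i\in\{1,\dots,n\}$ either $A_{i-1}\trianglelefteq A_i$ or $A_i/(A_{i-1})_{A_i}$ is $\sigma$-primary; it is $\mathfrak N_\sigma$-subnormal in $G$ if there is such a chain with $A_i/(A_{i-1})_{A_i}\in\mathfrak N_\sigma$ for each $i\in\{1,\dots,n\}$. A chief factor $H/K$ of a group $E$ is $\sigma$-central in $E$ if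 the semidirect product $(H/K)\rtimes(E/C_E(H/K))$, formed with the conjugation action, is $\sigma$-primary. The $\sigma$-nilpotent hypercentre $Z_\sigma(E)$ is the product of all normal subgroups $N$ of $E$ such that every chief factor $H/K$ of $E$ with $H\le N$ is $\sigma$-central in $E$ (the subgroup $N=1$ being included). **Corollary.** Let $G$ be a group and $S$ a subgroup of $G$ such that $Z_\sigma(E)=1$ for every subgroup $E$ of $G$ with $S\le E$. 1. If $S$ is $\sigma$-subnormal in $G$, then $C_G(S^{\mathfrak N_\sigma})\le S^{\mathfrak N_\sigma}$. 2. If $S$ is $\mathfrak N_\sigma$-subnormal in $G$, then $C_G(S^{\mathfrak N_\sigma})\le S^{\mathfrak N_\sigma}$. -/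

import Mathlib

universe u v

/-- A family `σ` of sets of natural numbers is a partition of the set of all primes. -/
structure IsPrimePartition {I : Type v} (σ : I → Set ℕ) : Prop where
  iUnion_eq : (⋃ i, σ i) = {p : ℕ | p.Prime}
  disjoint : ∀ i j : I, i ≠ j → Disjoint (σ i) (σ j)

/-- `G` is a finite `π`-group: every prime divisor of its order lies in `π`. -/
def IsPiGroup (π : Set ℕ) (G : Type u) [Group G] : Prop :=
  Finite G ∧ ∀ p : ℕ, p.Prime → p ∣ Nat.card G → p ∈ π

/-- `G` is `σ`-primary: a `σ i`-group for some `i`. -/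
def IsSigmaPrimary {I : Type v} (σ : I → Set ℕ) (G : Type u) [Group G] : Prop :=
  ∃ i : I, IsPiGroup (σ i) G

/-- `G` is `σ`-nilpotent: the direct product of finitely many `σ`-primary groups. -/
def IsSigmaNilpotent {I : Type v} (σ : I → Set ℕ) (G : Type u) [Group G] : Prop :=
  ∃ (t : ℕ) (P : Fin t → Type u) (_ : ∀ j, Group (P j)),
    (∀ j, IsSigmaPrimary σ (P j)) ∧ Nonempty (G ≃* (∀ j, P j))

/-- The `σ`-nilpotent residual of `G`: the intersection of all normal subgroups `N` of `G`
with `G ⧸ N` `σ`-nilpotent. -/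
def sigmaNilpotentResidual {I : Type v} (σ : I → Set ℕ) (G : Type u) [Group G] : Subgroup G :=
  sInf {N : Subgroup G | ∃ _ : N.Normal, IsSigmaNilpotent σ (G ⧸ N)}

/-- The core `A_B`, as a subgroup of `B` (used for `A ≤ B`): the largest normal subgroup of `B`
contained in `A`. -/
def coreIn {G : Type u} [Group G] (A B : Subgroup G) : Subgroup B :=
  (A.subgroupOf B).normalCore

instance {G : Type u} [Group G] (A B : Subgroup G) : (coreIn A B).Normal :=
  Subgroup.normalCore_normal _

/-- `S` is `σ`-subnormal in `G`: there is a chain `S = A 0 ≤ A 1 ≤ ⋯ ≤ A n = G` in which, at each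
step, the smaller group is normal in the larger one or the quotient of the larger group by the
core of the smaller one is `σ`-primary. -/
def IsSigmaSubnormal {I : Type v} (σ : I → Set ℕ) {G : Type u} [Group G]
    (S : Subgroup G) : Prop :=
  ∃ (n : ℕ) (A : ℕ → Subgroup G), A 0 = S ∧ A n = ⊤ ∧
    ∀ i < n, A i ≤ A (i + 1) ∧
      (((A i).subgroupOf (A (i + 1))).Normal ∨
        IsSigmaPrimary σ (↥(A (i + 1)) ⧸ coreIn (A i) (A (i + 1))))

/-- `S` is `𝔑_σ`-subnormal in `G`: there is a chain `S = A 0 ≤ A 1 ≤ ⋯ ≤ A n = G` in which, at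
each step, the quotient of the larger group by the core of the smaller one is `σ`-nilpotent. -/
def IsSigmaNilpotentSubnormal {I : Type v} (σ : I → Set ℕ) {G : Type u} [Group G]
    (S : Subgroup G) : Prop :=
  ∃ (n : ℕ) (A : ℕ → Subgroup G), A 0 = S ∧ A n = ⊤ ∧
    ∀ i < n, A i ≤ A (i + 1) ∧
      IsSigmaNilpotent σ (↥(A (i + 1)) ⧸ coreIn (A i) (A (i + 1)))

section ChiefFactor

/-- The section `H/K`, for `K ≤ H` with `K` normal in `E`, realised as the image of `H` in
`E ⧸ K`. -/
def sectionQuot {E : Type u} [Group E] (H K : Subgroup E) [K.Normal] : Subgroup (E ⧸ K) :=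
  H.map (QuotientGroup.mk' K)

instance sectionQuot_normal {E : Type u} [Group E] (H K : Subgroup E) [H.Normal] [K.Normal] :
    (sectionQuot H K).Normal :=
  Subgroup.Normal.map inferInstance _ (QuotientGroup.mk'_surjective K)

/-- The action of `E` on the normal section `H/K` by conjugation. -/
def sectionConj {E : Type u} [Group E] (H K : Subgroup E) [H.Normal] [K.Normal] :
    E →* MulAut (sectionQuot H K) :=
  (MulAut.conjNormal (H := sectionQuot H K)).comp (QuotientGroup.mk' K)

/-- The centraliser `C_E(H/K)` of the section `H/K`: the kernel of the conjugation action. -/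
def sectionCentralizer {E : Type u} [Group E] (H K : Subgroup E) [H.Normal] [K.Normal] :
    Subgroup E :=
  (sectionConj H K).ker

instance {E : Type u} [Group E] (H K : Subgroup E) [H.Normal] [K.Normal] :
    (sectionCentralizer H K).Normal :=
  MonoidHom.normal_ker _

theorem mem_sectionCentralizer_iff {E : Type u} [Group E] (H K : Subgroup E)
    [H.Normal] [K.Normal] (g : E) :
    g ∈ sectionCentralizer H K ↔ ∀ h ∈ H, g * h * g⁻¹ * h⁻¹ ∈ K := by
  rw [sectionCentralizer, MonoidHom.mem_ker]
  constructor
  · intro hg h hh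
    have h1 := congrArg (fun f : MulAut (sectionQuot H K) =>
      ((f ⟨QuotientGroup.mk' K h, Subgroup.mem_map_of_mem _ hh⟩ : sectionQuot H K) : E ⧸ K)) hg
    simp only [sectionConj, MonoidHom.comp_apply, MulAut.conjNormal_apply, MulAut.one_apply] at h1
    rw [← QuotientGroup.ker_mk' K, MonoidHom.mem_ker, map_mul, map_mul, map_mul, map_inv, map_inv,
      h1, mul_inv_cancel]
  · intro hg
    ext ⟨x, hx⟩
    obtain ⟨h, hh, rfl⟩ := hx
    have h1 := hg h hh
    rw [← QuotientGroup.ker_mk' K, MonoidHom.mem_ker, map_mul, map_mul, map_mul, map_inv, map_inv,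
      mul_inv_eq_one] at h1
    simpa only [sectionConj, MonoidHom.comp_apply, MulAut.conjNormal_apply, MulAut.one_apply]
      using h1

/-- The induced conjugation action of `E ⧸ C_E(H/K)` on `H/K`. -/
def sectionAction {E : Type u} [Group E] (H K : Subgroup E) [H.Normal] [K.Normal] :
    E ⧸ sectionCentralizer H K →* MulAut (sectionQuot H K) :=
  QuotientGroup.lift (sectionCentralizer H K) (sectionConj H K) (fun _ hg => hg)

/-- The normal section `H/K` is `σ`-central in `E`: the semidirect product
`(H/K) ⋊ (E/C_E(H/K))` is `σ`-primary. -/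
def IsSigmaCentral {I : Type v} (σ : I → Set ℕ) {E : Type u} [Group E]
    (H K : Subgroup E) [H.Normal] [K.Normal] : Prop :=
  IsSigmaPrimary σ (sectionQuot H K ⋊[sectionAction H K] (E ⧸ sectionCentralizer H K))

/-- `H/K` is a chief factor of `E` (for `H`, `K` normal in `E`): `K < H` and no normal subgroup
of `E` lies strictly between `K` and `H`. -/
def IsChiefFactor {E : Type u} [Group E] (H K : Subgroup E) : Prop :=
  K < H ∧ ∀ L : Subgroup E, L.Normal → K ≤ L → L ≤ H → L = K ∨ L = H

/-- Every chief factor `H/K` of `E` below `N` is `σ`-central in `E`. There is no chief factor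
below `N = 1`, so the trivial subgroup always has this property. -/
def IsSigmaHypercentral {I : Type v} (σ : I → Set ℕ) {E : Type u} [Group E]
    (N : Subgroup E) : Prop :=
  ∀ (H K : Subgroup E) [H.Normal] [K.Normal],
    IsChiefFactor H K → H ≤ N → IsSigmaCentral σ H K

/-- The `σ`-nilpotent hypercentre `Z_σ(E)`: the product (join) of all normal subgroups `N` of `E`
all of whose chief factors `H/K` of `E` below `N` are `σ`-central in `E`. -/
def sigmaHypercentre {I : Type v} (σ : I → Set ℕ) (E : Type u) [Group E] : Subgroup E :=
  sSup {N : Subgroup E | N.Normal ∧ IsSigmaHypercentral σ N}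

end ChiefFactor

/-! Only one trace of `σ`-nilpotency is used: `σ i`-elements commute with `σ i'`-elements. Let `D`
be the residual of `S` and `C = C_G(D)`.

If `D` is normal in `G` and this commuting holds modulo `D`, a `σ i`-element `c` of `C` outside `D`
is impossible (`centralizer_le_of_sigmaHypercentre_eq_bot`). The `σ i'`-elements of `G/D` form a
subgroup `N/D`, and averaging over it moves a power of `c`, modulo `D`, into `C_G(N)`. The `σ
i`-elements of `C_G(N)` form a normal subgroup, which is hypercentral because `G/N` is a `σ
i`-group, hence trivial. So `cD` has `σ i'`-order, and `c ∈ D`.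

In general, `C ∩ A k ≤ D` is proved by climbing the chain. The lemma is applied to `E = S(C ∩ F)`,
which normalises `D`; commuting modulo `D` passes from `S` to `E` because `E` and `S` agree modulo
`C` (`centralizer_inf_le_of_commutator_mem`). -/

open scoped commutatorElement

/-! ### Elements of `π`-order and the splitting into `π`- and `π'`-parts -/

/-- `x` is a `π`-element: every prime divisor of its order lies in `π`. -/
def IsPiElement (π : Set ℕ) {G : Type*} [Group G] (x : G) : Prop :=
  ∀ p : ℕ, p.Prime → p ∣ orderOf x → p ∈ π

namespace IsPiElement

variable {π : Set ℕ} {G H : Type*} [Group G] [Group H]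

theorem of_orderOf_dvd {x : G} {y : H} (hx : IsPiElement π x) (h : orderOf y ∣ orderOf x) :
    IsPiElement π y :=
  fun p hp hd => hx p hp (hd.trans h)

theorem map {x : G} (hx : IsPiElement π x) (f : G →* H) : IsPiElement π (f x) :=
  hx.of_orderOf_dvd (orderOf_map_dvd f x)

theorem pow {x : G} (hx : IsPiElement π x) (n : ℕ) : IsPiElement π (x ^ n) :=
  hx.of_orderOf_dvd (orderOf_pow_dvd n)

theorem inv {x : G} (hx : IsPiElement π x) : IsPiElement π x⁻¹ :=
  hx.of_orderOf_dvd (orderOf_inv x).dvd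

theorem map_iff {x : G} {f : G →* H} (hf : Function.Injective f) :
    IsPiElement π (f x) ↔ IsPiElement π x := by
  simp only [IsPiElement, orderOf_injective f hf]

theorem conj {x : G} (hx : IsPiElement π x) (g : G) : IsPiElement π (g * x * g⁻¹) := by
  simpa using hx.map (MulAut.conj g).toMonoidHom

theorem one : IsPiElement π (1 : G) := fun p hp hd => by
  rw [orderOf_one] at hd
  exact absurd hd hp.not_dvd_one

theorem mul {x y : G} (hx : IsPiElement π x) (hy : IsPiElement π y) (h : Commute x y) :
    IsPiElement π (x * y) := by
  intro p hp hd
  have h1 : p ∣ orderOf x * orderOf y := (hd.trans h.orderOf_mul_dvd_lcm).trans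
    (Nat.lcm_dvd_mul _ _)
  exact (hp.dvd_mul.1 h1).elim (hx p hp) (hy p hp)

theorem eq_one {x : G} (hx : IsPiElement π x) (hx' : IsPiElement πᶜ x) : x = 1 := by
  by_contra hne
  obtain ⟨p, hp, hd⟩ := Nat.exists_prime_and_dvd (mt orderOf_eq_one_iff.1 hne)
  exact hx' p hp hd (hx p hp hd)

theorem of_card {x : G} (h : ∀ p : ℕ, p.Prime → p ∣ Nat.card G → p ∈ π) : IsPiElement π x :=
  fun p hp hd => h p hp (hd.trans (orderOf_dvd_natCard x))

theorem of_pow_eq_one {x : G} {n : ℕ} (h : ∀ p : ℕ, p.Prime → p ∣ n → p ∈ π)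
    (hx : x ^ n = 1) : IsPiElement π x :=
  fun p hp hd => h p hp (hd.trans (orderOf_dvd_of_pow_eq_one hx))

end IsPiElement

/-- A group all of whose elements are `π`-elements is a `π`-group. -/
theorem mem_of_dvd_natCard_of_isPiElement {π : Set ℕ} {G : Type*} [Group G] [Finite G]
    (h : ∀ x : G, IsPiElement π x) (p : ℕ) (hp : p.Prime) (hd : p ∣ Nat.card G) : p ∈ π := by
  have := Fact.mk hp
  obtain ⟨x, hx⟩ := exists_prime_orderOf_dvd_card' p hd
  exact h x p hp hx.symm.dvd

theorem exists_mul_eq_of_primes (π : Set ℕ) (n : ℕ) (hn : n ≠ 0) : ∃ a b : ℕ, a * b = n ∧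
    (∀ p : ℕ, p.Prime → p ∣ a → p ∈ π) ∧ ∀ p : ℕ, p.Prime → p ∣ b → p ∈ πᶜ := by
  induction n using induction_on_primes with
  | zero => exact absurd rfl hn
  | one =>
    exact ⟨1, 1, rfl, fun p hp hd => absurd hd hp.not_dvd_one,
      fun p hp hd => absurd hd hp.not_dvd_one⟩
  | prime_mul q m hq ih =>
    obtain ⟨a, b, rfl, ha, hb⟩ := ih (right_ne_zero_of_mul hn)
    by_cases h : q ∈ π
    · refine ⟨q * a, b, mul_assoc _ _ _, fun p hp hd => ?_, hb⟩
      rcases hp.dvd_mul.1 hd with h1 | h1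
      · rwa [(Nat.prime_dvd_prime_iff_eq hp hq).1 h1]
      · exact ha p hp h1
    · refine ⟨a, q * b, mul_left_comm _ _ _, ha, fun p hp hd => ?_⟩
      rcases hp.dvd_mul.1 hd with h1 | h1
      · rwa [(Nat.prime_dvd_prime_iff_eq hp hq).1 h1]
      · exact hb p hp h1

/-- Every element of a finite group is the product of a power that is a `π`-element and a power
that is a `π'`-element. -/
theorem exists_pow_isPiElement_mul (π : Set ℕ) {G : Type*} [Group G] [Finite G] (s : G) :
    ∃ n m : ℕ, IsPiElement π (s ^ n) ∧ IsPiElement πᶜ (s ^ m) ∧ s ^ n * s ^ m = s := by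
  obtain ⟨a, b, hab, ha, hb⟩ := exists_mul_eq_of_primes π (orderOf s) (orderOf_pos s).ne'
  have hco : a.Coprime b := Nat.coprime_of_dvd fun p hp h1 h2 => hb p hp h2 (ha p hp h1)
  -- Modulo `(a, b)`, `n` is `(1, 0)` and `m` is `(0, 1)`, so `n + m` is `1` modulo the order of
  -- `s`.
  obtain ⟨n, hn1, hn0⟩ := Nat.chineseRemainder hco 1 0
  obtain ⟨m, hm0, hm1⟩ := Nat.chineseRemainder hco 0 1
  refine ⟨n, m, IsPiElement.of_pow_eq_one ha ?_, IsPiElement.of_pow_eq_one hb ?_, ?_⟩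
  · rw [← pow_mul, ← orderOf_dvd_iff_pow_eq_one, ← hab, mul_comm a b]
    exact Nat.mul_dvd_mul ((Nat.modEq_zero_iff_dvd).1 hn0) dvd_rfl
  · rw [← pow_mul, ← orderOf_dvd_iff_pow_eq_one, ← hab]
    exact Nat.mul_dvd_mul ((Nat.modEq_zero_iff_dvd).1 hm0) dvd_rfl
  · rw [← pow_add]
    conv_rhs => rw [← pow_one s]
    rw [pow_eq_pow_iff_modEq, ← hab]
    exact (Nat.modEq_and_modEq_iff_modEq_mul hco).1 ⟨hn1.add hm0, hn0.add hm1⟩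

/-- A `π`-element of a homomorphic image, given as the image of `s`, is already the image of a
power of `s` that is a `π`-element. -/
theorem exists_pow_isPiElement_map_eq {π : Set ℕ} {G H : Type*} [Group G] [Group H] [Finite G]
    (f : G →* H) (s : G) (hs : IsPiElement π (f s)) :
    ∃ n : ℕ, IsPiElement π (s ^ n) ∧ f (s ^ n) = f s := by
  obtain ⟨n, m, hn, hm, h⟩ := exists_pow_isPiElement_mul π s
  refine ⟨n, hn, ?_⟩
  have h1 : f (s ^ m) = 1 := IsPiElement.eq_one (π := π) (by simpa using hs.pow m) (hm.map f)
  conv_rhs => rw [← h, map_mul, h1, mul_one]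

/-- The index of a normal subgroup that contains all `π'`-elements is a `π`-number. -/
theorem mem_of_dvd_index_of_isPiElement {π : Set ℕ} {G : Type*} [Group G] [Finite G]
    (N : Subgroup G) [N.Normal] (h : ∀ x : G, IsPiElement πᶜ x → x ∈ N) (p : ℕ) (hp : p.Prime)
    (hd : p ∣ N.index) : p ∈ π := by
  refine mem_of_dvd_natCard_of_isPiElement (G := G ⧸ N) (fun x => ?_) p hp hd
  obtain ⟨s, rfl⟩ := QuotientGroup.mk'_surjective N x
  obtain ⟨n, m, hn, hm, hs⟩ := exists_pow_isPiElement_mul π s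
  have h1 : QuotientGroup.mk' N (s ^ m) = 1 := (QuotientGroup.eq_one_iff _).2 (h _ hm)
  rw [← hs, map_mul, h1, mul_one]
  exact hn.map _

/-! ### Subgroups formed by the `π`-elements -/

/-- If all `π'`-elements of a finite group are central, then its `π`-elements form a subgroup. -/
theorem exists_subgroup_mem_iff_isPiElement {π : Set ℕ} {R : Type*} [Group R] [Finite R]
    (h : ∀ x : R, IsPiElement πᶜ x → ∀ y : R, Commute x y) :
    ∃ Q : Subgroup R, ∀ x, x ∈ Q ↔ IsPiElement π x := by
  let B : Subgroup R :=
    { carrier := {x | IsPiElement πᶜ x}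
      mul_mem' := fun {x y} hx hy => IsPiElement.mul hx hy (h x hx y)
      one_mem' := IsPiElement.one
      inv_mem' := fun {x} hx => IsPiElement.inv hx }
  have : B.Normal := ⟨fun x hx g => IsPiElement.conj hx g⟩
  have hBcard : ∀ p : ℕ, p.Prime → p ∣ Nat.card B → p ∈ πᶜ :=
    mem_of_dvd_natCard_of_isPiElement fun x =>
      (IsPiElement.map_iff (f := B.subtype) B.subtype_injective).1 x.2
  have hBind : ∀ p : ℕ, p.Prime → p ∣ B.index → p ∈ π :=
    mem_of_dvd_index_of_isPiElement B fun x hx => hx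
  -- Schur–Zassenhaus: the `π'`-elements form a normal Hall subgroup `B`. Its complement contains
  -- every `π`-element because `B` is central.
  obtain ⟨Q, hQ⟩ := Subgroup.exists_right_complement'_of_coprime (N := B)
    (Nat.coprime_of_dvd fun p hp h1 h2 => hBcard p hp h1 (hBind p hp h2))
  have hQpi : ∀ x ∈ Q, IsPiElement π x := fun x hx => by
    have h1 : IsPiElement π (⟨x, hx⟩ : Q) := IsPiElement.of_card fun p hp hd =>
      hBind p hp (by rwa [hQ.symm.index_eq_card])
    exact h1.map Q.subtype
  refine ⟨Q, fun x => ⟨hQpi x, fun hx => ?_⟩⟩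
  obtain ⟨⟨⟨b, hb⟩, ⟨q, hq⟩⟩, rfl⟩ := hQ.2 x
  have hb1 : b = 1 := by
    refine IsPiElement.eq_one (π := π) ?_ hb
    have h1 : IsPiElement π (b * q * q⁻¹) :=
      hx.mul (hQpi q hq).inv (Commute.inv_right ((h b hb q).mul_left (Commute.refl q)))
    simpa using h1
  simpa [hb1] using hq

/-- If the `π`-elements of a finite group commute with the `π'`-elements, then the `π`-elements form
a subgroup. -/
theorem exists_subgroup_mem_iff_isPiElement_of_commute {π : Set ℕ} {H : Type*} [Group H] [Finite H]
    (h : ∀ x y : H, IsPiElement π x → IsPiElement πᶜ y → Commute x y) :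
    ∃ Q : Subgroup H, ∀ x, x ∈ Q ↔ IsPiElement π x := by
  -- Inside the subgroup generated by the `π`-elements, every `π'`-element is central.
  let A : Subgroup H := Subgroup.closure {x | IsPiElement π x}
  have hA : ∀ y : H, IsPiElement πᶜ y → ∀ x ∈ A, Commute y x := fun y hy x hx => by
    have h1 : A ≤ Subgroup.centralizer {y} := by
      rw [Subgroup.closure_le]
      intro x hx
      exact Subgroup.mem_centralizer_singleton_iff.2 (h x y hx hy).eq
    exact (Subgroup.mem_centralizer_singleton_iff.1 (h1 hx)).symm
  obtain ⟨Q, hQ⟩ := exists_subgroup_mem_iff_isPiElement (π := π) (R := A) fun x hx y =>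
    Subtype.ext (hA x (hx.map A.subtype) y y.2).eq
  refine ⟨Q.map A.subtype, fun x => ⟨?_, fun hx => ?_⟩⟩
  · rintro ⟨y, hy, rfl⟩
    exact ((hQ y).1 hy).map _
  · have hxA : x ∈ A := Subgroup.subset_closure hx
    exact ⟨⟨x, hxA⟩, (hQ _).2 ((IsPiElement.map_iff A.subtype_injective).1 hx), rfl⟩

/-! ### Averaging and the case of a normal `D` -/

/-- An averaging argument: if `c` centralises the normal subgroup `D` and is fixed modulo `D` by
conjugation with the elements of `N`, where `N / D = B`, then some element of the coset
`c ^ |B| D` centralises `N`. -/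
theorem exists_pow_mul_mem_centralizer_comap {G : Type*} [Group G] (D : Subgroup G) [D.Normal]
    (B : Subgroup (G ⧸ D)) [Finite B] (c : G) (hc : c ∈ Subgroup.centralizer (D : Set G))
    (hB : ∀ w ∈ B, Commute (c : G ⧸ D) w) :
    ∃ z ∈ D, c ^ Nat.card B * z ∈
      Subgroup.centralizer ((B.comap (QuotientGroup.mk' D) : Subgroup G) : Set G) := by
  let Z : Subgroup G := D ⊓ Subgroup.centralizer (D : Set G)
  let _ : CommGroup Z :=
    { (inferInstance : Group Z) with mul_comm := fun a b => Subtype.ext (b.2.2 a a.2.1) }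
  have hZnormal : Z.Normal := inferInstance
  have := Fintype.ofFinite B
  have hmem : ∀ y : G, (y : G ⧸ D) ∈ B → c⁻¹ * (y * c * y⁻¹) ∈ Z := fun y hy => by
    refine Subgroup.mem_inf.2 ⟨?_, mul_mem (inv_mem hc)
      ((inferInstance : (Subgroup.centralizer (D : Set G)).Normal).conj_mem c hc y)⟩
    rw [← QuotientGroup.eq_one_iff]
    have h1 := (hB _ hy).eq
    simp only [QuotientGroup.mk_mul, QuotientGroup.mk_inv]
    rw [← h1]
    group
  -- The 1-cocycle `yD ↦ c⁻¹ (y c y⁻¹)` with values in `Z(D)`. It does not depend on the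
  -- representative since `c` centralises `D`. The product of its values shows that its `|B|`-th
  -- power is a coboundary.
  let f : B → Z := fun w => ⟨c⁻¹ * (Quotient.out w.1 * c * (Quotient.out w.1)⁻¹),
    hmem _ (by rw [QuotientGroup.out_eq']; exact w.2)⟩
  have hf : ∀ (w : B) (y : G), (y : G ⧸ D) = w.1 → (f w : G) = c⁻¹ * (y * c * y⁻¹) := by
    intro w y hy
    have h1 : y⁻¹ * Quotient.out w.1 ∈ D := by
      rw [← QuotientGroup.eq, hy, QuotientGroup.out_eq']
    have h2 := hc _ h1
    change c⁻¹ * (Quotient.out w.1 * c * (Quotient.out w.1)⁻¹) = _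
    congr 1
    calc Quotient.out w.1 * c * (Quotient.out w.1)⁻¹
        = y * ((y⁻¹ * Quotient.out w.1) * c) * (Quotient.out w.1)⁻¹ := by group
      _ = y * (c * (y⁻¹ * Quotient.out w.1)) * (Quotient.out w.1)⁻¹ := by rw [h2]
      _ = y * c * y⁻¹ := by group
  have hcoc : ∀ (y : G) (hy : (y : G ⧸ D) ∈ B) (w : B),
      f (⟨y, hy⟩ * w) = f ⟨y, hy⟩ * MulAut.conjNormal y (f w) := by
    intro y hy w
    apply Subtype.ext
    obtain ⟨x, hx⟩ := QuotientGroup.mk_surjective w.1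
    rw [hf (⟨y, hy⟩ * w) (y * x) (by rw [QuotientGroup.mk_mul, hx]; rfl), Subgroup.coe_mul,
      MulAut.conjNormal_apply, hf w x hx, hf ⟨y, hy⟩ y rfl]
    group
  refine ⟨((∏ w : B, f w : Z) : G), (∏ w : B, f w : Z).2.1, ?_⟩
  intro y hy
  have hy' : (y : G ⧸ D) ∈ B := hy
  have hprod : ∏ w : B, f w =
      f ⟨y, hy'⟩ ^ Nat.card B * MulAut.conjNormal y (∏ w : B, f w) := by
    rw [map_prod, Nat.card_eq_fintype_card, ← Finset.card_univ, ← Finset.prod_const,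
      ← Finset.prod_mul_distrib, ← Equiv.prod_comp (Equiv.mulLeft (⟨y, hy'⟩ : B))]
    exact Finset.prod_congr rfl fun w _ => hcoc y hy' w
  have hprod' := congrArg (Subtype.val) hprod
  rw [Subgroup.coe_mul, Subgroup.coe_pow, MulAut.conjNormal_apply, hf ⟨y, hy'⟩ y rfl] at hprod'
  have hcom : Commute c (c⁻¹ * (y * c * y⁻¹)) := (hc _ (hmem y hy').1).symm
  have h3 : c ^ Nat.card B * (c⁻¹ * (y * c * y⁻¹)) ^ Nat.card B = y * c ^ Nat.card B * y⁻¹ := by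
    rw [← hcom.mul_pow, mul_inv_cancel_left, conj_pow]
  have h4 : c ^ Nat.card B * ((∏ w : B, f w : Z) : G) =
      y * (c ^ Nat.card B * ((∏ w : B, f w : Z) : G)) * y⁻¹ := by
    conv_lhs => rw [hprod', ← mul_assoc, h3]
    group
  conv_rhs => rw [h4]
  group

/-- A normal `π`-subgroup whose centraliser contains a normal subgroup of `π`-index is
`σ`-hypercentral, for `π` a member of `σ`. -/
theorem isSigmaHypercentral_of_centralizer {I : Type v} (σ : I → Set ℕ) (i : I) {G : Type u}
    [Group G] [Finite G] (N Q : Subgroup G)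
    (hN : ∀ p : ℕ, p.Prime → p ∣ N.index → p ∈ σ i) (hQ : ∀ x ∈ Q, IsPiElement (σ i) x)
    (hNQ : Q ≤ Subgroup.centralizer (N : Set G)) : IsSigmaHypercentral σ Q := by
  intro H K hH hK _ hHQ
  refine ⟨i, ?_, fun p hp hd => ?_⟩
  · exact Finite.of_equiv _ SemidirectProduct.equivProd.symm
  · rw [SemidirectProduct.card] at hd
    rcases hp.dvd_mul.1 hd with h1 | h1
    -- `H/K` is an image of a `σ i`-group; `N` centralises `H`, so `|E/C_E(H/K)|` divides the index
    -- of `N`.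
    · refine mem_of_dvd_natCard_of_isPiElement (G := sectionQuot H K) (fun x => ?_) p hp h1
      obtain ⟨x, h, hh, rfl⟩ := x
      rw [← IsPiElement.map_iff (f := (sectionQuot H K).subtype) Subtype.val_injective]
      exact (hQ h (hHQ hh)).map (QuotientGroup.mk' K)
    · refine hN p hp (h1.trans ?_)
      refine Subgroup.index_dvd_of_le fun y hy => (mem_sectionCentralizer_iff H K y).2 fun h hh => ?_
      have h2 := hNQ (hHQ hh) y hy
      rw [h2, mul_inv_cancel_right, mul_inv_cancel]
      exact one_mem K

theorem IsPrimePartition.exists_mem {I : Type v} {σ : I → Set ℕ} (hσ : IsPrimePartition σ) {p : ℕ}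
    (hp : p.Prime) : ∃ i, p ∈ σ i := by
  have h : p ∈ ⋃ i, σ i := by rw [hσ.iUnion_eq]; exact hp
  exact Set.mem_iUnion.1 h

/-- If `D` is normal in `G`, the `σ i`-elements and the `σ i'`-elements of `G` commute modulo `D` for
all `i`, and the `σ`-nilpotent hypercentre of `G` is trivial, then `C_G(D) ≤ D`. -/
theorem centralizer_le_of_sigmaHypercentre_eq_bot {I : Type v} {σ : I → Set ℕ}
    (hσ : IsPrimePartition σ) {G : Type u} [Group G] [Finite G] (D : Subgroup G) [D.Normal]
    (hD : ∀ (i : I) (x y : G), IsPiElement (σ i) x → IsPiElement (σ i)ᶜ y → ⁅x, y⁆ ∈ D)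
    (hZ : sigmaHypercentre σ G = ⊥) : Subgroup.centralizer (D : Set G) ≤ D := by
  intro c₀ hc₀
  by_contra hcD₀
  obtain ⟨p, hp, hpc⟩ := Nat.exists_prime_and_dvd
    (mt orderOf_eq_one_iff.1 (mt (QuotientGroup.eq_one_iff (N := D) c₀).1 hcD₀))
  obtain ⟨i, hi⟩ := hσ.exists_mem hp
  obtain ⟨c, hc, hcpi, hcD⟩ : ∃ c ∈ Subgroup.centralizer (D : Set G),
      IsPiElement (σ i) c ∧ c ∉ D := by
    -- If the `σ i`-part of `c₀` were in `D`, then `p` could not divide the order of `c₀D`.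
    obtain ⟨n, m, hn, hm, h⟩ := exists_pow_isPiElement_mul (σ i) c₀
    refine ⟨c₀ ^ n, pow_mem hc₀ n, hn, fun h1 => ?_⟩
    have h2 : (c₀ : G ⧸ D) = QuotientGroup.mk' D (c₀ ^ m) := by
      conv_lhs => rw [← h, QuotientGroup.mk_mul, (QuotientGroup.eq_one_iff _).2 h1, one_mul]
      rfl
    exact (hm.map (QuotientGroup.mk' D)) p hp (by rwa [← h2]) hi
  have hcomm : ∀ x y : G ⧸ D, IsPiElement (σ i) x → IsPiElement (σ i)ᶜ y → Commute x y := by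
    intro x y hx hy
    obtain ⟨s, rfl⟩ := QuotientGroup.mk'_surjective D x
    obtain ⟨t, rfl⟩ := QuotientGroup.mk'_surjective D y
    obtain ⟨n, hn, hsn⟩ := exists_pow_isPiElement_map_eq _ s hx
    obtain ⟨m, hm, htm⟩ := exists_pow_isPiElement_map_eq _ t hy
    rw [← hsn, ← htm, ← commutatorElement_eq_one_iff_commute, ← map_commutatorElement]
    exact (QuotientGroup.eq_one_iff _).2 (hD i _ _ hn hm)
  obtain ⟨B, hB⟩ := exists_subgroup_mem_iff_isPiElement_of_commute (π := (σ i)ᶜ) (H := G ⧸ D)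
    fun x y hx hy => (hcomm y x (by rwa [compl_compl] at hy) hx).symm
  have hBn : B.Normal := ⟨fun x hx g => (hB _).2 (((hB x).1 hx).conj g)⟩
  let N : Subgroup G := B.comap (QuotientGroup.mk' D)
  have hNmem : ∀ x : G, IsPiElement (σ i)ᶜ x → x ∈ N := fun x hx => (hB _).2 (hx.map _)
  have hcpi' : IsPiElement (σ i) (c : G ⧸ D) := hcpi.map (QuotientGroup.mk' D)
  obtain ⟨z, hzD, hz⟩ := exists_pow_mul_mem_centralizer_comap D B c hc fun w hw =>
    hcomm _ _ hcpi' ((hB w).1 hw)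
  let R : Subgroup G := Subgroup.centralizer (N : Set G)
  have hRn : R.Normal := inferInstance
  -- The `σ i'`-elements of `R` lie in `N`, so `R = C_G(N)` centralises them.
  obtain ⟨Q, hQ⟩ := exists_subgroup_mem_iff_isPiElement (π := σ i) (R := R) fun x hx y =>
    Subtype.ext (y.2 x (hNmem x (hx.map R.subtype)))
  let Q' : Subgroup G := Q.map R.subtype
  have hQ' : ∀ x, x ∈ Q' ↔ x ∈ R ∧ IsPiElement (σ i) x := by
    refine fun x => ⟨?_, fun hx => ⟨⟨x, hx.1⟩, (hQ _).2
      ((IsPiElement.map_iff R.subtype_injective).1 hx.2), rfl⟩⟩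
    rintro ⟨y, hy, rfl⟩
    exact ⟨y.2, ((hQ y).1 hy).map _⟩
  have hQn : Q'.Normal := ⟨fun x hx g => (hQ' _).2
    ⟨hRn.conj_mem x ((hQ' x).1 hx).1 g, ((hQ' x).1 hx).2.conj g⟩⟩
  have hQbot : Q' ≤ ⊥ := by
    rw [← hZ]
    refine le_sSup ⟨hQn, isSigmaHypercentral_of_centralizer σ i N Q'
      (mem_of_dvd_index_of_isPiElement N hNmem) (fun x hx => ((hQ' x).1 hx).2)
      fun x hx => ((hQ' x).1 hx).1⟩
  -- As `Q'` is trivial, the `σ i`-part of this element of `R` is trivial.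
  have hxpi : IsPiElement (σ i)ᶜ (c ^ Nat.card B * z) := by
    obtain ⟨n, m, hn, hm, h⟩ := exists_pow_isPiElement_mul (σ i) (c ^ Nat.card B * z)
    have h1 := Subgroup.mem_bot.1 (hQbot ((hQ' _).2 ⟨pow_mem hz n, hn⟩))
    rw [h1, one_mul] at h
    rwa [← h]
  have hmk : QuotientGroup.mk' D (c ^ Nat.card B * z) = (c : G ⧸ D) ^ Nat.card B := by
    rw [map_mul, map_pow]
    simp only [QuotientGroup.mk'_apply]
    rw [(QuotientGroup.eq_one_iff z).2 hzD, mul_one]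
  have h1 : (c : G ⧸ D) ^ Nat.card B = 1 :=
    (hcpi'.pow _).eq_one (by simpa only [hmk] using hxpi.map (QuotientGroup.mk' D))
  have h2 : IsPiElement (σ i)ᶜ (c : G ⧸ D) := IsPiElement.of_pow_eq_one
    (mem_of_dvd_natCard_of_isPiElement fun x =>
      (IsPiElement.map_iff (f := B.subtype) B.subtype_injective).1 ((hB x).1 x.2)) h1
  exact hcD ((QuotientGroup.eq_one_iff c).1 (hcpi'.eq_one h2))

/-! ### Commuting elements in `σ`-nilpotent groups -/

/-- One of the two elements is trivial: `y` if the group is a `σ i`-group, and otherwise `x`, by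
disjointness. -/
theorem IsSigmaPrimary.commute {I : Type v} {σ : I → Set ℕ} (hσ : IsPrimePartition σ) {H : Type u}
    [Group H] (hH : IsSigmaPrimary σ H) {i : I} {x y : H} (hx : IsPiElement (σ i) x)
    (hy : IsPiElement (σ i)ᶜ y) : Commute x y := by
  obtain ⟨j, -, hj⟩ := hH
  by_cases hij : i = j
  · subst hij
    rw [(IsPiElement.of_card hj : IsPiElement (σ i) y).eq_one hy]
    exact Commute.one_right x
  · have h1 : IsPiElement (σ i)ᶜ x := fun p hp hd =>
      Set.disjoint_right.1 (hσ.disjoint i j hij) ((IsPiElement.of_card hj : IsPiElement (σ j) x) p hp hd)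
    rw [hx.eq_one h1]
    exact Commute.one_left y

theorem IsSigmaNilpotent.commute {I : Type v} {σ : I → Set ℕ} (hσ : IsPrimePartition σ) {H : Type u}
    [Group H] (hH : IsSigmaNilpotent σ H) {i : I} {x y : H} (hx : IsPiElement (σ i) x)
    (hy : IsPiElement (σ i)ᶜ y) : Commute x y := by
  obtain ⟨t, P, _, hP, ⟨e⟩⟩ := hH
  apply e.injective
  ext j
  simp only [map_mul, Pi.mul_apply]
  exact (hP j).commute hσ (hx.map ((Pi.evalMonoidHom P j).comp e.toMonoidHom))
    (hy.map ((Pi.evalMonoidHom P j).comp e.toMonoidHom))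

/-- Modulo the `σ`-nilpotent residual, the `σ i`-elements and the `σ i'`-elements commute. -/
theorem commutator_mem_sigmaNilpotentResidual {I : Type v} {σ : I → Set ℕ}
    (hσ : IsPrimePartition σ) {H : Type u} [Group H] {i : I} {x y : H}
    (hx : IsPiElement (σ i) x) (hy : IsPiElement (σ i)ᶜ y) :
    ⁅x, y⁆ ∈ sigmaNilpotentResidual σ H := by
  refine Subgroup.mem_sInf.2 fun N hN => ?_
  obtain ⟨_, hN⟩ := hN
  rw [← QuotientGroup.eq_one_iff]
  exact commutatorElement_eq_one_iff_commute.2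
    (hN.commute hσ (hx.map (QuotientGroup.mk' N)) (hy.map (QuotientGroup.mk' N)))

theorem sigmaNilpotentResidual_normal {I : Type v} (σ : I → Set ℕ) (H : Type u) [Group H] :
    (sigmaNilpotentResidual σ H).Normal :=
  ⟨fun x hx g => Subgroup.mem_sInf.2 fun N hN =>
    hN.1.conj_mem x (Subgroup.mem_sInf.1 hx N hN) g⟩

/-! ### Climbing the chain -/

section

variable {I : Type v} {σ : I → Set ℕ} {G : Type u} [Group G] [Finite G] {S D : Subgroup G}

/-- If `C_G(D)` meets `M` in a subgroup of `D`, and the `σ i`-elements and `σ i'`-elements of `F`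
commute modulo `M`, then `C_G(D)` meets `F` in a subgroup of `D`. -/
theorem centralizer_inf_le_of_commutator_mem (hσ : IsPrimePartition σ) (hDS : D ≤ S)
    (hSD : S ≤ Subgroup.normalizer (D : Set G))
    (hS : ∀ (i : I), ∀ x ∈ S, ∀ y ∈ S,
      IsPiElement (σ i) x → IsPiElement (σ i)ᶜ y → ⁅x, y⁆ ∈ D)
    (hZ : ∀ E : Subgroup G, S ≤ E → sigmaHypercentre σ E = ⊥) {M F : Subgroup G} (hDM : D ≤ M)
    (hSF : S ≤ F) (hM : Subgroup.centralizer (D : Set G) ⊓ M ≤ D)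
    (hF : ∀ (i : I), ∀ x ∈ F, ∀ y ∈ F,
      IsPiElement (σ i) x → IsPiElement (σ i)ᶜ y → ⁅x, y⁆ ∈ M) :
    Subgroup.centralizer (D : Set G) ⊓ F ≤ D := by
  set C : Subgroup G := Subgroup.centralizer (D : Set G) with hC
  let E : Subgroup G := S ⊔ C ⊓ F
  let L : Subgroup G := Subgroup.normalizer (D : Set G)
  have hCL : C ≤ L := Subgroup.centralizer_le_normalizer _
  have hEL : E ≤ L := sup_le hSD (inf_le_left.trans hCL)
  have hEF : E ≤ F := sup_le hSF inf_le_right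
  have hCn : (C.subgroupOf L).Normal := by
    refine ⟨fun c hc g => ?_⟩
    rw [Subgroup.mem_subgroupOf] at hc ⊢
    intro d hd
    have hd' : (g : G)⁻¹ * d * g ∈ D := by
      have := (Subgroup.mem_normalizer_iff.1 (inv_mem g.2) d).1 hd
      simpa using this
    have h1 := hc _ hd'
    calc d * (g * c * (g : G)⁻¹) = g * ((g : G)⁻¹ * d * g * c) * (g : G)⁻¹ := by group
      _ = g * (c * ((g : G)⁻¹ * d * g)) * (g : G)⁻¹ := by rw [h1]
      _ = g * c * (g : G)⁻¹ * d := by group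
  let f : L →* L ⧸ C.subgroupOf L := QuotientGroup.mk' _
  have hfE : E.subgroupOf L ≤ ((S.subgroupOf L).map f).comap f := by
    have h1 : E.subgroupOf L = S.subgroupOf L ⊔ (C ⊓ F).subgroupOf L :=
      Subgroup.subgroupOf_sup hSD (inf_le_left.trans hCL)
    rw [h1]
    refine sup_le (Subgroup.le_comap_map _ _) fun x hx => ?_
    have h2 : f x = 1 := (QuotientGroup.eq_one_iff x).2 (show x ∈ C.subgroupOf L from hx.1)
    rw [Subgroup.mem_comap, h2]
    exact one_mem _
  have hlift : ∀ (π : Set ℕ) (x : L), (x : G) ∈ E → IsPiElement π x →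
      ∃ s : L, (s : G) ∈ S ∧ IsPiElement π s ∧ f s = f x := by
    intro π x hx hxπ
    obtain ⟨s, hs, hsx⟩ := hfE (show x ∈ E.subgroupOf L from hx)
    obtain ⟨n, hn, hsn⟩ := exists_pow_isPiElement_map_eq f s (π := π)
      (by rw [hsx]; exact hxπ.map f)
    exact ⟨s ^ n, pow_mem hs n, hn, hsn.trans hsx⟩
  have hcomm : ∀ (i : I) (x y : L), (x : G) ∈ E → (y : G) ∈ E →
      IsPiElement (σ i) x → IsPiElement (σ i)ᶜ y → ⁅(x : G), (y : G)⁆ ∈ D := by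
    intro i x y hx hy hxπ hyπ
    obtain ⟨s, hs, hsπ, hsx⟩ := hlift _ x hx hxπ
    obtain ⟨t, ht, htπ, hty⟩ := hlift _ y hy hyπ
    have hst : ⁅(s : G), (t : G)⁆ ∈ D :=
      hS i s hs t ht (hsπ.map L.subtype) (htπ.map L.subtype)
    have hxy : ⁅(x : G), (y : G)⁆ ∈ M :=
      hF i x (hEF hx) y (hEF hy) (hxπ.map L.subtype) (hyπ.map L.subtype)
    have h1 : f ⁅s, t⁆ = f ⁅x, y⁆ := by
      rw [map_commutatorElement, map_commutatorElement, hsx, hty]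
    have h2 : ⁅s, t⁆⁻¹ * ⁅x, y⁆ ∈ C.subgroupOf L := QuotientGroup.eq.1 h1
    -- Modulo `C`, `⁅x, y⁆` equals `⁅s, t⁆ ∈ D ≤ M`; the discrepancy lies in `C ∩ M ≤ D`.
    have h3 := hM (Subgroup.mem_inf.2 ⟨h2, mul_mem (inv_mem (hDM hst)) hxy⟩)
    have h4 : ⁅(s : G), (t : G)⁆ * (⁅(s : G), (t : G)⁆⁻¹ * ⁅(x : G), (y : G)⁆) ∈ D :=
      mul_mem hst h3
    rwa [mul_inv_cancel_left] at h4
  have hDE : D ≤ E := hDS.trans le_sup_left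
  have hDn : (D.subgroupOf E).Normal :=
    (Subgroup.normal_subgroupOf_iff_le_normalizer hDE).2 hEL
  have key := centralizer_le_of_sigmaHypercentre_eq_bot hσ (D.subgroupOf E)
    (fun i x y hx hy => hcomm i ⟨x, hEL x.2⟩ ⟨y, hEL y.2⟩ x.2 y.2
      (hx.map (Subgroup.inclusion hEL)) (hy.map (Subgroup.inclusion hEL)))
    (hZ E le_sup_left)
  intro c hc
  have hcE : c ∈ E := (le_sup_right : C ⊓ F ≤ E) hc
  exact key (x := ⟨c, hcE⟩) fun d hd => Subtype.ext (hc.1 d hd)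

/-- The form of the result that covers both kinds of subnormality: `D` need not be the residual. -/
theorem centralizer_le_of_chain (hσ : IsPrimePartition σ) (hDS : D ≤ S)
    (hSD : S ≤ Subgroup.normalizer (D : Set G))
    (hS : ∀ (i : I), ∀ x ∈ S, ∀ y ∈ S,
      IsPiElement (σ i) x → IsPiElement (σ i)ᶜ y → ⁅x, y⁆ ∈ D)
    (hZ : ∀ E : Subgroup G, S ≤ E → sigmaHypercentre σ E = ⊥) (n : ℕ) (A : ℕ → Subgroup G)
    (h0 : A 0 = S) (hn : A n = ⊤)
    (hA : ∀ k < n, A k ≤ A (k + 1) ∧ (((A k).subgroupOf (A (k + 1))).Normal ∨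
      ∀ (i : I) (x y : A (k + 1)),
        IsPiElement (σ i) x → IsPiElement (σ i)ᶜ y → ⁅x, y⁆ ∈ coreIn (A k) (A (k + 1)))) :
    Subgroup.centralizer (D : Set G) ≤ D := by
  have main : ∀ k ≤ n, S ≤ A k ∧ Subgroup.centralizer (D : Set G) ⊓ A k ≤ D := by
    intro k
    induction k with
    | zero =>
      intro _
      refine ⟨h0.ge, ?_⟩
      rw [h0]
      -- Here `M = D` and `F = S`.
      exact centralizer_inf_le_of_commutator_mem hσ hDS hSD hS hZ le_rfl le_rfl inf_le_right hS
    | succ k ih =>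
      intro hk
      obtain ⟨hSA, hCA⟩ := ih (Nat.le_of_succ_le hk)
      obtain ⟨hle, hstep⟩ := hA k hk
      refine ⟨hSA.trans hle, ?_⟩
      rcases hstep with hnormal | hcore
      · intro c hc
        let f : A (k + 1) →* A (k + 1) ⧸ (A k).subgroupOf (A (k + 1)) := QuotientGroup.mk' _
        let c' : A (k + 1) := ⟨c, hc.2⟩
        -- The quotient `A (k + 1) / A k` may be arbitrary, so each `c` is treated separately: `F /
        -- A k` is cyclic, which puts all commutators of `F` in `A k`.
        let F : Subgroup G := ((Subgroup.zpowers (f c')).comap f).map (A (k + 1)).subtype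
        have hSF : S ≤ F := fun s hs => ⟨⟨s, hle (hSA hs)⟩, by
          have h1 : f ⟨s, hle (hSA hs)⟩ = 1 := (QuotientGroup.eq_one_iff _).2
            (show _ ∈ (A k).subgroupOf (A (k + 1)) from hSA hs)
          rw [SetLike.mem_coe, Subgroup.mem_comap, h1]
          exact one_mem _, rfl⟩
        refine centralizer_inf_le_of_commutator_mem hσ hDS hSD hS hZ (hDS.trans hSA) hSF hCA ?_
          ⟨hc.1, ⟨c', Subgroup.mem_zpowers _, rfl⟩⟩
        rintro i _ ⟨x, hx, rfl⟩ _ ⟨y, hy, rfl⟩ - -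
        obtain ⟨a, ha⟩ := Subgroup.mem_zpowers_iff.1 hx
        obtain ⟨b, hb⟩ := Subgroup.mem_zpowers_iff.1 hy
        have h1 : f ⁅x, y⁆ = 1 := by
          rw [map_commutatorElement, commutatorElement_eq_one_iff_commute, ← ha, ← hb]
          exact Commute.zpow_zpow_self _ _ _
        have h2 : ⁅x, y⁆ ∈ (A k).subgroupOf (A (k + 1)) := (QuotientGroup.eq_one_iff _).1 h1
        exact h2
      · refine centralizer_inf_le_of_commutator_mem hσ hDS hSD hS hZ (hDS.trans hSA)
          (hSA.trans hle) hCA fun i x hx y hy hxπ hyπ => ?_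
        have h1 : ⁅(⟨x, hx⟩ : A (k + 1)), ⟨y, hy⟩⁆ ∈ (A k).subgroupOf (A (k + 1)) :=
          Subgroup.normalCore_le _ (hcore i _ _
            ((IsPiElement.map_iff (A (k + 1)).subtype_injective).1 hxπ)
            ((IsPiElement.map_iff (A (k + 1)).subtype_injective).1 hyπ))
        exact h1
  intro c hc
  exact (main n le_rfl).2 ⟨hc, hn ▸ Subgroup.mem_top c⟩

/-- The case of `centralizer_le_of_chain` in which `D` is the `σ`-nilpotent residual of `S`. -/
theorem centralizer_sigmaNilpotentResidual_le_of_chain (hσ : IsPrimePartition σ)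
    (hZ : ∀ E : Subgroup G, S ≤ E → sigmaHypercentre σ E = ⊥) (n : ℕ) (A : ℕ → Subgroup G)
    (h0 : A 0 = S) (hn : A n = ⊤)
    (hA : ∀ k < n, A k ≤ A (k + 1) ∧ (((A k).subgroupOf (A (k + 1))).Normal ∨
      ∀ (i : I) (x y : A (k + 1) ⧸ coreIn (A k) (A (k + 1))),
        IsPiElement (σ i) x → IsPiElement (σ i)ᶜ y → Commute x y)) :
    Subgroup.centralizer (((sigmaNilpotentResidual σ S).map S.subtype : Subgroup G) : Set G)
      ≤ (sigmaNilpotentResidual σ S).map S.subtype := by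
  have hnormal := sigmaNilpotentResidual_normal σ S
  refine centralizer_le_of_chain hσ (Subgroup.map_subtype_le _) ?_ ?_ hZ n A h0 hn fun k hk =>
    ⟨(hA k hk).1, (hA k hk).2.imp_right fun h i x y hx hy => ?_⟩
  · rw [← Subgroup.normal_subgroupOf_iff_le_normalizer (Subgroup.map_subtype_le _),
      Subgroup.subgroupOf, Subgroup.comap_map_eq_self_of_injective S.subtype_injective]
    exact hnormal
  · intro i x hx y hy hxπ hyπ
    exact ⟨⁅⟨x, hx⟩, ⟨y, hy⟩⁆, commutator_mem_sigmaNilpotentResidual hσ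
      ((IsPiElement.map_iff S.subtype_injective).1 hxπ)
      ((IsPiElement.map_iff S.subtype_injective).1 hyπ), rfl⟩
  · rw [← QuotientGroup.eq_one_iff]
    exact commutatorElement_eq_one_iff_commute.2
      (h i _ _ (hx.map (QuotientGroup.mk' _)) (hy.map (QuotientGroup.mk' _)))

end

theorem mainTheorem5 {I : Type v} (σ : I → Set ℕ) (hσ : IsPrimePartition σ)
    (G : Type u) [Group G] [Finite G] :
    (∀ S : Subgroup G, IsSigmaSubnormal σ S →
      (∀ E : Subgroup G, S ≤ E → sigmaHypercentre σ E = ⊥) →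
        Subgroup.centralizer (((sigmaNilpotentResidual σ S).map S.subtype : Subgroup G) : Set G)
          ≤ (sigmaNilpotentResidual σ S).map S.subtype) ∧
    (∀ S : Subgroup G, IsSigmaNilpotentSubnormal σ S →
      (∀ E : Subgroup G, S ≤ E → sigmaHypercentre σ E = ⊥) →
        Subgroup.centralizer (((sigmaNilpotentResidual σ S).map S.subtype : Subgroup G) : Set G)
          ≤ (sigmaNilpotentResidual σ S).map S.subtype) := by
  refine ⟨fun S hS hZ => ?_, fun S hS hZ => ?_⟩
  · obtain ⟨n, A, h0, hn, hA⟩ := hS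
    exact centralizer_sigmaNilpotentResidual_le_of_chain hσ hZ n A h0 hn fun k hk =>
      ⟨(hA k hk).1, (hA k hk).2.imp_right fun h i x y hx hy => h.commute hσ hx hy⟩
  · obtain ⟨n, A, h0, hn, hA⟩ := hS
    exact centralizer_sigmaNilpotentResidual_le_of_chain hσ hZ n A h0 hn fun k hk =>
      ⟨(hA k hk).1, Or.inr fun i x y hx hy => (hA k hk).2.commute hσ hx hy⟩
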